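/- All signatures are finite and relational, structures are nonempty, and equality is always available. Consider formulas built from relational atoms, equalities, atoms $X\vec x$ with second-order variables $X$, the connectives $\wedge,\vee,\neg$, quantifiers $\exists$ and least fixpoints $[\mathrm{LFP}\,X,\vec x\,.\,\alpha(\vec x)\wedge\varphi](\vec y)$, where $\vec x$ are distinct variables, $\alpha$ is a relational atom or an equality with free variables exactly $\vec x$, the free first-order variables of $\varphi$ are among $\vec x$, and $X$ occurs only positively in $\varphi$. A *guard* is a relational atom or an equality (never an atom $X\vec x$). In *guarded fixpoint logic* GFP, negation is unrestricted, but quantification is allowed only in the form $\exists\vec x\,(\alpha\wedge\varphi)$, where $\alpha$ is a guard whose free variables include $\vec x$ and all free variables of $\varphi$. In *guarded negation fixpoint logic* GNFP, quantification is unrestricted, but negation is allowed only in the form $\alpha\wedge\neg\varphi$, where $\alpha$ is a guard containing all free variables of $\varphi$. An *interpolant* for an entailment $\varphi\models\psi$ between sentences is a formula $\theta$ (without free second-order variables) such that $\varphi\models\theta$, $\theta\models\psi$, and every relation symbol of $\theta$ occurs both in $\varphi$ and in $\psi$. A logic has *Craig interpolation* if for all its sentences $\varphi,\psi$ with $\varphi\models\psi$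 there is an interpolant in the logic. **Proposition.** GNFP does not have Craig interpolation, neither with respect to entailment over all structures nor with respect to entailment over finite structures. Moreover, there are GFP sentences $\varphi$, whose relation symbols are $G$ (ternary), $Q$ (unary) and $R$ (binary), and $\psi$, whose relation symbols are $P$ (unary), $Q$ and $R$, such that: 1. $\varphi\models\psi$ over all structures; 2. there is no GNFP interpolant for $\varphi\models\psi$; and even if both entailments in the definition of an interpolant are required over finite structures only, there is none; 3. for every $k\in\mathbb N$, the finite $\{G,P,Q,R\}$-structures $\mathfrak A_k$ and $\mathfrak B_k$ below satisfy $\mathfrak A_k\models\varphi$ and $\mathfrak B_k\not\models\psi$, and they are $\mathrm{BGN}^k[\{Q,R\}]$-bisimilar. Here $\mathfrak A_k$ is a directed $R$-cycle of length $k+1$ with $P$ true at exactly one element. $\mathfrak B_k$ consists of an $R$-chain $c_1\to c_2\to c_3$ with a directed $R$-cycle of length $k+1$ attached at $c_1$ and another one attached at $c_3$ (two disjoint cycles, not containing $c_2$), with $P$ true exactly at $c_2$. In both structures $Q$ holds of all elements and $G$ of all triples. For a signature $\tau$, two structures $\mathfrak A,\mathfrak B$ are *$\mathrm{BGN}^k[\tau]$-bisimilar*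 if Duplicator can play forever in the following game. Positions are partial $\tau$-homomorphisms $h$, with domain of size at most $k$, from one of the structures (the *active* one) to the other. The initial position is the empty map from $\mathfrak A$ to $\mathfrak B$. In each round Spoiler first makes one of two moves: either he *extends*, choosing a set $X\supseteq\mathrm{dom}(h)$ of at most $k$ elements of the active structure, and Duplicator must extend $h$ to a partial $\tau$-homomorphism with domain $X$; or he *switches*, which is allowed if $\mathrm{dom}(h)$ is strictly guarded in the active structure: then Duplicator loses unless $h$ is a partial $\tau$-isomorphism, and otherwise $h$ is replaced by $h^{-1}$ and the other structure becomes active. Then Spoiler *collapses* the current map to a subset of its domain that is strictly guarded in the active structure. A set is *strictly guarded* if it is empty, a singleton, or the set of all components of a tuple in some relation of $\tau$. -/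

import Mathlib

universe u

/-- The relation symbols of a first-order language, bundled with their arities. -/
abbrev RelSymb (L : FirstOrder.Language.{0, 0}) : Type := Σ n : ℕ, L.Relations n

/-- Raw formulas of least fixpoint logic over the relation symbols of `L`. First-order variables are
natural numbers; a second-order variable is a pair of an arity `n` and a name `X : ℕ`. The formula
`lfp X x φ y` is `[LFP X, x . φ](y)`. -/
inductive FPFormula (L : FirstOrder.Language.{0, 0}) : Type
  | rel {n : ℕ} (R : L.Relations n) (x : Fin n → ℕ) : FPFormula L
  | eq (x y : ℕ) : FPFormula L
  | so {n : ℕ} (X : ℕ) (x : Fin n → ℕ) : FPFormula L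
  | and (φ ψ : FPFormula L) : FPFormula L
  | or (φ ψ : FPFormula L) : FPFormula L
  | not (φ : FPFormula L) : FPFormula L
  | ex (x : ℕ) (φ : FPFormula L) : FPFormula L
  | lfp {n : ℕ} (X : ℕ) (x : Fin n → ℕ) (φ : FPFormula L) (y : Fin n → ℕ) : FPFormula L

namespace FPFormula

variable {L : FirstOrder.Language.{0, 0}}

/-- The block of existential quantifiers `∃ x₁ … xₘ . φ`. -/
def exs (xs : List ℕ) (φ : FPFormula L) : FPFormula L := xs.foldr ex φ

/-- Free first-order variables. -/
def freeVars : FPFormula L → Set ℕ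
  | rel _ x => Set.range x
  | eq x y => {x, y}
  | so _ x => Set.range x
  | and φ ψ => φ.freeVars ∪ ψ.freeVars
  | or φ ψ => φ.freeVars ∪ ψ.freeVars
  | not φ => φ.freeVars
  | ex x φ => φ.freeVars \ {x}
  | lfp _ x φ y => (φ.freeVars \ Set.range x) ∪ Set.range y

/-- Free second-order variables, as pairs (arity, name). -/
def freeSOVars : FPFormula L → Set (ℕ × ℕ)
  | rel _ _ => ∅
  | eq _ _ => ∅
  | so (n := n) X _ => {(n, X)}
  | and φ ψ => φ.freeSOVars ∪ ψ.freeSOVars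
  | or φ ψ => φ.freeSOVars ∪ ψ.freeSOVars
  | not φ => φ.freeSOVars
  | ex _ φ => φ.freeSOVars
  | lfp (n := n) X _ φ _ => φ.freeSOVars \ {(n, X)}

/-- The relation symbols of `L` that occur in a formula (equality is a logical symbol). -/
def rels : FPFormula L → Set (RelSymb L)
  | rel (n := n) R _ => {⟨n, R⟩}
  | eq _ _ => ∅
  | so _ _ => ∅
  | and φ ψ => φ.rels ∪ ψ.rels
  | or φ ψ => φ.rels ∪ ψ.rels
  | not φ => φ.rels
  | ex _ φ => φ.rels
  | lfp _ _ φ _ => φ.rels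

/-- `φ.HasPolarity Z b`: every free occurrence in `φ` of the second-order variable `Z` (a pair of an
arity and a name) is positive, i.e. under an even number of negations, if `b = true`, and negative
if `b = false`. -/
def HasPolarity (Z : ℕ × ℕ) : FPFormula L → Bool → Prop
  | rel _ _, _ => True
  | eq _ _, _ => True
  | so (n := n) X _, b => (n, X) = Z → b = true
  | and φ ψ, b => φ.HasPolarity Z b ∧ ψ.HasPolarity Z b
  | or φ ψ, b => φ.HasPolarity Z b ∧ ψ.HasPolarity Z b
  | not φ, b => φ.HasPolarity Z (!b)
  | ex _ φ, b => φ.HasPolarity Z b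
  | lfp (n := n) X _ φ _, b => (n, X) = Z ∨ φ.HasPolarity Z b

/-- No free first-order and no free second-order variables. -/
def IsSentence (φ : FPFormula L) : Prop := φ.freeVars = ∅ ∧ φ.freeSOVars = ∅

/-- Guards: relational atoms over the signature, or equalities. Second-order variables are
not guards. -/
inductive IsGuard : FPFormula L → Prop
  | rel {n : ℕ} (R : L.Relations n) (x : Fin n → ℕ) : IsGuard (rel R x)
  | eq (x y : ℕ) : IsGuard (eq x y)

/-- The formulas of guarded negation fixpoint logic `GNFP`. -/
inductive IsGNFP : FPFormula L → Prop
  | rel {n : ℕ} (R : L.Relations n) (x : Fin n → ℕ) : IsGNFP (rel R x)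
  | eq (x y : ℕ) : IsGNFP (eq x y)
  | so {n : ℕ} (X : ℕ) (x : Fin n → ℕ) : IsGNFP (so X x)
  | and {φ ψ : FPFormula L} : IsGNFP φ → IsGNFP ψ → IsGNFP (and φ ψ)
  | or {φ ψ : FPFormula L} : IsGNFP φ → IsGNFP ψ → IsGNFP (or φ ψ)
  | ex (x : ℕ) {φ : FPFormula L} : IsGNFP φ → IsGNFP (ex x φ)
  | guardedNot {α φ : FPFormula L} : IsGuard α → IsGNFP φ → φ.freeVars ⊆ α.freeVars →
      IsGNFP (and α (not φ))
  | lfp {n : ℕ} (X : ℕ) (x : Fin n → ℕ) {α φ : FPFormula L} (y : Fin n → ℕ) :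
      Function.Injective x → IsGuard α → α.freeVars = Set.range x →
      IsGNFP φ → φ.freeVars ⊆ Set.range x → φ.HasPolarity (n, X) true →
      IsGNFP (lfp X x (and α φ) y)

/-- The formulas of guarded fixpoint logic `GFP`. -/
inductive IsGFP : FPFormula L → Prop
  | rel {n : ℕ} (R : L.Relations n) (x : Fin n → ℕ) : IsGFP (rel R x)
  | eq (x y : ℕ) : IsGFP (eq x y)
  | so {n : ℕ} (X : ℕ) (x : Fin n → ℕ) : IsGFP (so X x)
  | and {φ ψ : FPFormula L} : IsGFP φ → IsGFP ψ → IsGFP (and φ ψ)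
  | or {φ ψ : FPFormula L} : IsGFP φ → IsGFP ψ → IsGFP (or φ ψ)
  | not {φ : FPFormula L} : IsGFP φ → IsGFP (not φ)
  | guardedEx (xs : List ℕ) {α φ : FPFormula L} : IsGuard α → IsGFP φ →
      (∀ x ∈ xs, x ∈ α.freeVars) → φ.freeVars ⊆ α.freeVars → IsGFP (exs xs (and α φ))
  | lfp {n : ℕ} (X : ℕ) (x : Fin n → ℕ) {α φ : FPFormula L} (y : Fin n → ℕ) :
      Function.Injective x → IsGuard α → α.freeVars = Set.range x →
      IsGFP φ → φ.freeVars ⊆ Set.range x → φ.HasPolarity (n, X) true →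
      IsGFP (lfp X x (and α φ) y)

section Semantics

variable {M : Type u} [L.Structure M]

/-- Satisfaction under a valuation `v` of the first-order and a valuation `V` of the second-order
variables. `[LFP X, x . φ](y)` says that `y` lies in the least fixpoint of the operator
`U ↦ {a | φ holds under x ↦ a, X ↦ U}`, which for an operator that is monotone (as it is when `X`
occurs only positively in `φ`) is the intersection of all `U` that it maps into themselves.
For injective `x`, `Function.extend x a v` sends `x i` to `a i` and is `v` elsewhere. -/
def Realize : FPFormula L → (ℕ → M) → ((n : ℕ) → ℕ → Set (Fin n → M)) → Prop
  | rel R x, v, _ => FirstOrder.Language.Structure.RelMap R (fun i => v (x i))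
  | eq x y, v, _ => v x = v y
  | so (n := n) X x, v, V => (fun i => v (x i)) ∈ V n X
  | and φ ψ, v, V => φ.Realize v V ∧ ψ.Realize v V
  | or φ ψ, v, V => φ.Realize v V ∨ ψ.Realize v V
  | not φ, v, V => ¬ φ.Realize v V
  | ex x φ, v, V => ∃ a : M, φ.Realize (Function.update v x a) V
  | lfp (n := n) X x φ y, v, V =>
      (fun i => v (y i)) ∈ sInf {U : Set (Fin n → M) |
        {a | φ.Realize (Function.extend x a v)
          (Function.update V n (Function.update (V n) X U))} ⊆ U}

variable (M) in
/-- Truth in a structure (under every valuation; for a sentence the valuation is irrelevant). -/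
def Holds (φ : FPFormula L) : Prop :=
  ∀ (v : ℕ → M) (V : (n : ℕ) → ℕ → Set (Fin n → M)), φ.Realize v V

/-- Entailment over all (nonempty) structures. -/
def Entails (φ ψ : FPFormula L) : Prop :=
  ∀ (M : Type u) [L.Structure M] [Nonempty M] (v : ℕ → M) (V : (n : ℕ) → ℕ → Set (Fin n → M)),
    φ.Realize v V → ψ.Realize v V

/-- Entailment over all finite (nonempty) structures. -/
def FinEntails (φ ψ : FPFormula L) : Prop :=
  ∀ (M : Type u) [L.Structure M] [Nonempty M] [Finite M] (v : ℕ → M)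
    (V : (n : ℕ) → ℕ → Set (Fin n → M)), φ.Realize v V → ψ.Realize v V

end Semantics

/-- `θ` is an interpolant for `φ` and `ψ` with respect to the entailment relation `Ent`. Free
first-order variables are allowed in `θ`. -/
def IsInterpolant (Ent : FPFormula L → FPFormula L → Prop) (φ ψ θ : FPFormula L) : Prop :=
  θ.freeSOVars = ∅ ∧ Ent φ θ ∧ Ent θ ψ ∧ θ.rels ⊆ φ.rels ∩ ψ.rels

/-- A logic (given by its formulas over each signature) has Craig interpolation with respect to an
entailment relation, for finite relational signatures. -/
def HasCraigInterpolation (Logic : (L : FirstOrder.Language.{0, 0}) → FPFormula L → Prop)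
    (Ent : (L : FirstOrder.Language.{0, 0}) → FPFormula L → FPFormula L → Prop) : Prop :=
  ∀ (L : FirstOrder.Language.{0, 0}) [L.IsRelational] [Finite (RelSymb L)] (φ ψ : FPFormula L),
    Logic L φ → Logic L ψ → φ.IsSentence → ψ.IsSentence → Ent L φ ψ →
      ∃ θ : FPFormula L, Logic L θ ∧ IsInterpolant (Ent L) φ ψ θ

end FPFormula

section Bisimulation

universe v

variable {L : FirstOrder.Language.{0, 0}} {M : Type u} {N : Type v} [L.Structure M] [L.Structure N]

/-- The domain of a partial map, given by its graph. -/
def graphDom (h : Set (M × N)) : Set M := Prod.fst '' h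

/-- The inverse graph. -/
def graphInv (h : Set (M × N)) : Set (N × M) := Prod.swap '' h

/-- Restriction of (the graph of) a partial map to `Y`. -/
def graphRestrict (h : Set (M × N)) (Y : Set M) : Set (M × N) := {p ∈ h | p.1 ∈ Y}

/-- `h` is the graph of a partial homomorphism from `M` to `N` with respect to the relation symbols
in `S`. -/
def IsPartialHom (S : Set (RelSymb L)) (h : Set (M × N)) : Prop :=
  (∀ a b b', (a, b) ∈ h → (a, b') ∈ h → b = b') ∧
  ∀ (n : ℕ) (R : L.Relations n), (⟨n, R⟩ : RelSymb L) ∈ S → ∀ (a : Fin n → M) (b : Fin n → N),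
    (∀ i, (a i, b i) ∈ h) → FirstOrder.Language.Structure.RelMap R a → FirstOrder.Language.Structure.RelMap R b

/-- `h` is the graph of a partial isomorphism with respect to `S`: an injective partial map that
preserves the relations of `S` in both directions. -/
def IsPartialIso (S : Set (RelSymb L)) (h : Set (M × N)) : Prop :=
  IsPartialHom S h ∧ IsPartialHom S (graphInv h)

/-- `Y` is strictly guarded with respect to the guard relations `Sg`: it is empty, or a singleton
(guarded by an equality), or exactly the set of elements of a tuple in some relation of `Sg`. -/
def StrictlyGuarded (Sg : Set (RelSymb L)) (Y : Set M) : Prop :=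
  Y = ∅ ∨ (∃ a, Y = {a}) ∨
  ∃ (n : ℕ) (R : L.Relations n) (a : Fin n → M), (⟨n, R⟩ : RelSymb L) ∈ Sg ∧
    FirstOrder.Language.Structure.RelMap R a ∧ Y = Set.range a

/-- One half of the closure condition on Duplicator's winning region in the block `k`-width guarded
negation bisimulation game. `W` and `W'` are sets of positions with active structure `M` and `N`
respectively, at which Spoiler is to make an extend or a switch move. At every `h ∈ W`:
for each extension `X` of the domain to at most `k` elements, Duplicator has an answer `h'` on `X`
each of whose collapses to a strictly guarded set is in `W`; and, if the domain of `h` is strictly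
guarded, `h` is a partial isomorphism and, after the switch to `h⁻¹`, each collapse to a
strictly guarded set is in `W'`. -/
def BGNClosed (k : ℕ) (S Sg : Set (RelSymb L)) (W : Set (Set (M × N))) (W' : Set (Set (N × M))) :
    Prop :=
  ∀ h ∈ W,
    (IsPartialHom S h ∧ (graphDom h).encard ≤ k) ∧
    (∀ X : Set M, graphDom h ⊆ X → X.encard ≤ k →
      ∃ h' : Set (M × N), h ⊆ h' ∧ graphDom h' = X ∧ IsPartialHom S h' ∧
        ∀ Y ⊆ X, StrictlyGuarded Sg Y → graphRestrict h' Y ∈ W) ∧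
    (StrictlyGuarded Sg (graphDom h) →
      IsPartialIso S h ∧
        ∀ Y ⊆ graphDom (graphInv h), StrictlyGuarded Sg Y → graphRestrict (graphInv h) Y ∈ W')

variable (M N) in
/-- `M` and `N` are `BGNᵏ[S, Sg]`-bisimilar: Duplicator can play forever in the block `k`-width
guarded negation bisimulation game from the empty position with active structure `M`, i.e. this
position lies in a region that Duplicator never has to leave and in which she never loses. -/
def BGNBisimilar (k : ℕ) (S Sg : Set (RelSymb L)) : Prop :=
  ∃ (W : Set (Set (M × N))) (W' : Set (Set (N × M))),
    ∅ ∈ W ∧ BGNClosed k S Sg W W' ∧ BGNClosed k S Sg W' W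

end Bisimulation

/-- A ternary relation symbol `G`, unary relation symbols `P`, `Q` and a binary relation
symbol `R`. -/
inductive LassoRel : ℕ → Type
  | G : LassoRel 3
  | P : LassoRel 1
  | Q : LassoRel 1
  | R : LassoRel 2

/-- The relational signature `{G, P, Q, R}`. -/
def lassoLang : FirstOrder.Language.{0, 0} := ⟨fun _ => Empty, LassoRel⟩

/-- `G`, `P`, `Q`, `R` as relation symbols of `lassoLang`. -/
def symbG : RelSymb lassoLang := ⟨3, LassoRel.G⟩
def symbP : RelSymb lassoLang := ⟨1, LassoRel.P⟩
def symbQ : RelSymb lassoLang := ⟨1, LassoRel.Q⟩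
def symbR : RelSymb lassoLang := ⟨2, LassoRel.R⟩

/-- The structure on `D` in which `R` is the given edge relation, `P` holds exactly at the given
point, `Q` holds everywhere and `G` holds of all triples. -/
abbrev markedGraphStructure {D : Type} (edge : D → D → Prop) (p : D) : lassoLang.Structure D where
  funMap := fun f _ => f.elim
  RelMap := fun r x =>
    match r, x with
    | LassoRel.G, _ => True
    | LassoRel.P, x => x 0 = p
    | LassoRel.Q, _ => True
    | LassoRel.R, x => edge (x 0) (x 1)

/-- Carrier of the first structure: an `R`-loop of length `k + 1`. -/
def SingleLoop (k : ℕ) : Type := Fin (k + 1)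

/-- The edges of the loop go from `i` to `i + 1` (modulo `k + 1`). -/
def SingleLoop.Edge {k : ℕ} (i j : SingleLoop k) : Prop :=
  (show Fin (k + 1) from j) = (show Fin (k + 1) from i) + 1

instance (k : ℕ) : lassoLang.Structure (SingleLoop k) :=
  markedGraphStructure SingleLoop.Edge (0 : Fin (k + 1))

/-- Carrier of the second structure: a chain `first 0, mid, last 0` of three elements, where
`first 0` lies on a loop `first 0, …, first k` and `last 0` lies on a loop `last 0, …, last k`. -/
inductive DoubleLasso (k : ℕ) : Type
  | first (i : Fin (k + 1)) : DoubleLasso k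
  | mid : DoubleLasso k
  | last (i : Fin (k + 1)) : DoubleLasso k

/-- The edges of the double lasso: those of the chain and those of the two loops. -/
inductive DoubleLasso.Edge {k : ℕ} : DoubleLasso k → DoubleLasso k → Prop
  | firstLoop (i : Fin (k + 1)) : Edge (first i) (first (i + 1))
  | firstMid : Edge (first 0) mid
  | midLast : Edge mid (last 0)
  | lastLoop (i : Fin (k + 1)) : Edge (last i) (last (i + 1))

instance (k : ℕ) : lassoLang.Structure (DoubleLasso k) :=
  markedGraphStructure DoubleLasso.Edge DoubleLasso.mid

/-! Take for `φ` the sentence `allOnCycle` (every `Q`-element lies on an `R`-cycle) and for `ψ` the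
sentence `allReturnToP` (every `Q`-element in `P` reaches an element of `P`). An element on a cycle
reaches itself, so `φ` entails `ψ`. The symbol `G` only serves to guard the transitive closure in
`φ`, so the common vocabulary is `{Q, R}`.

The single loop satisfies `φ`, and the double lasso refutes `ψ`: from `mid`, the only point of `P`,
one never returns. Over `{Q, R}` the two are nevertheless bisimilar at width `k`
(`bgnBisimilar_singleLoop_doubleLasso`). At most `k` elements of a loop of length `k + 1` leave a
gap, so they can be unrolled along a walk in the lasso. Conversely, the whole lasso wraps around the
loop.

GNFP formulas are preserved by the game at a width computed from the formula
(`IsGNFP.hasWitnesses`). An interpolant `θ` fixes such a width `k`; it holds in the loop, hence is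
satisfiable in the lasso, which would force `ψ` there. Both structures are finite, so the argument
refutes interpolants over finite structures too, and both failures of Craig interpolation follow
because `φ` and `ψ` are themselves in GNFP. -/

theorem graphDom_graphRestrict {M N : Type*} {h : Set (M × N)} {Y : Set M} (hY : Y ⊆ graphDom h) :
    graphDom (graphRestrict h Y) = Y := by
  ext a
  constructor
  · rintro ⟨p, hp, rfl⟩; exact hp.2
  · intro ha
    obtain ⟨p, hp, rfl⟩ := hY ha
    exact ⟨p, ⟨hp, ha⟩, rfl⟩

/-! ### Preservation of GNFP formulas along the bisimulation game -/

namespace FPFormula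

variable {L : FirstOrder.Language.{0, 0}}

/-- A bound on the number of elements that Spoiler needs to play in order to exhibit witnesses for
a formula and its subformulas. -/
def size : FPFormula L → ℕ
  | rel (n := n) _ _ => n
  | eq _ _ => 2
  | so _ _ => 0
  | and φ ψ => φ.size + ψ.size
  | or φ ψ => φ.size + ψ.size
  | not φ => φ.size
  | ex _ φ => φ.size + 1
  | lfp (n := n) _ _ φ _ => φ.size + n

theorem hasPolarity_of_notMem_freeSOVars {Z : ℕ × ℕ} (φ : FPFormula L) :
    Z ∉ φ.freeSOVars → ∀ b, φ.HasPolarity Z b := by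
  induction φ with
  | rel | eq => intros; trivial
  | so X x => intro h b e; exact absurd e.symm h
  | and φ ψ h₁ h₂ | or φ ψ h₁ h₂ =>
    intro h b
    exact ⟨h₁ (fun h' => h (Or.inl h')) b, h₂ (fun h' => h (Or.inr h')) b⟩
  | not φ ih => intro h b; exact ih h _
  | ex x φ ih => intro h b; exact ih h _
  | @lfp n X x φ y ih =>
    intro h b
    by_cases e : Z = (n, X)
    · exact Or.inl e.symm
    · exact Or.inr (ih (fun h' => h ⟨h', e⟩) b)

section Invariance

variable {M N : Type u} [L.Structure M] [L.Structure N]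

/-- A partial homomorphism all of whose collapses to strictly guarded sets are positions in `W`. -/
def IsCollapsible (S : Set (RelSymb L)) (W : Set (Set (M × N))) (h : Set (M × N)) : Prop :=
  IsPartialHom S h ∧ ∀ Y ⊆ graphDom h, StrictlyGuarded S Y → graphRestrict h Y ∈ W

/-- The positions in `W` map the tuples in `U` to tuples in `U'`, and all tuples in `U` are
strictly guarded. -/
def SOForward (S : Set (RelSymb L)) (W : Set (Set (M × N))) {n : ℕ}
    (U : Set (Fin n → M)) (U' : Set (Fin n → N)) : Prop :=
  ∀ a ∈ U, StrictlyGuarded S (Set.range a) ∧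
    ∀ h ∈ W, ∀ b : Fin n → N, (∀ i, (a i, b i) ∈ h) → b ∈ U'

/-- Compatibility of two second-order valuations with the positions in `W` and `W'`, for the
second-order variables that occur positively, respectively negatively, in `φ`. -/
def SOCompatible (S : Set (RelSymb L)) (W : Set (Set (M × N))) (W' : Set (Set (N × M)))
    (φ : FPFormula L) (V : (n : ℕ) → ℕ → Set (Fin n → M)) (V' : (n : ℕ) → ℕ → Set (Fin n → N)) :
    Prop :=
  ∀ n X, (¬ φ.HasPolarity (n, X) false → SOForward S W (V n X) (V' n X)) ∧
    (¬ φ.HasPolarity (n, X) true → SOForward S W' (V' n X) (V n X))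

theorem strictlyGuarded_of_isGuard {S : Set (RelSymb L)} {α : FPFormula L} (hα : α.IsGuard)
    (hS : α.rels ⊆ S) {v : ℕ → M} {V : (n : ℕ) → ℕ → Set (Fin n → M)} (h : α.Realize v V) :
    StrictlyGuarded S (v '' α.freeVars) := by
  cases hα with
  | rel R x =>
    refine Or.inr (Or.inr ⟨_, R, fun i => v (x i), hS rfl, h, ?_⟩)
    simp only [freeVars]
    rw [← Set.range_comp]
    rfl
  | eq x y =>
    refine Or.inr (Or.inl ⟨v x, ?_⟩)
    have h : v x = v y := h
    simp [freeVars, Set.image_pair, h]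

theorem realize_of_isGuard {S : Set (RelSymb L)} {α : FPFormula L} (hα : α.IsGuard)
    (hS : α.rels ⊆ S) {h : Set (M × N)} (hh : IsPartialHom S h) {v : ℕ → M} {w : ℕ → N}
    (hvw : ∀ x ∈ α.freeVars, (v x, w x) ∈ h)
    {V : (n : ℕ) → ℕ → Set (Fin n → M)} {V' : (n : ℕ) → ℕ → Set (Fin n → N)}
    (hv : α.Realize v V) : α.Realize w V' := by
  cases hα with
  | rel R x => exact hh.2 _ R (hS rfl) _ _ (fun i => hvw _ ⟨i, rfl⟩) hv
  | eq x y =>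
    have h₁ := hvw x (by simp [freeVars])
    have h₂ := hvw y (by simp [freeVars])
    have e : v x = v y := hv
    rw [← e] at h₂
    exact hh.1 _ _ _ h₁ h₂

theorem encard_image_freeVars_le {α : FPFormula L} {D : Type*} (hα : α.IsGuard) (v : ℕ → D) :
    (v '' α.freeVars).encard ≤ α.size := by
  refine (Set.encard_image_le _ _).trans ?_
  cases hα with
  | rel R x =>
    simp only [freeVars, size]
    rw [← Set.image_univ]
    refine (Set.encard_image_le _ _).trans ?_
    simp
  | eq x y => exact (Set.encard_insert_le _ _).trans (by simp [size, one_add_one_eq_two])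

/-- If `φ` holds in `M`, then there are at most `φ.size` elements of `M` such that `φ` is preserved
by all collapsible partial homomorphisms that are defined on them. -/
def HasWitnesses (S : Set (RelSymb L)) (W : Set (Set (M × N))) (W' : Set (Set (N × M)))
    (φ : FPFormula L) : Prop :=
  ∀ (v : ℕ → M) (V : (n : ℕ) → ℕ → Set (Fin n → M)) (V' : (n : ℕ) → ℕ → Set (Fin n → N)),
    SOCompatible S W W' φ V V' → φ.Realize v V →
    ∃ X : Set M, X.encard ≤ φ.size ∧ ∀ h : Set (M × N), IsCollapsible S W h → X ⊆ graphDom h →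
      ∀ w : ℕ → N, (∀ x ∈ φ.freeVars, (v x, w x) ∈ h) → φ.Realize w V'

/-- One extend move of Spoiler, made to cover a set of witnesses. -/
theorem isCollapsible_of_bgnClosed {k : ℕ} {S : Set (RelSymb L)} {W : Set (Set (M × N))}
    {W' : Set (Set (N × M))} (hW : BGNClosed k S S W W') {h : Set (M × N)} (hh : h ∈ W)
    {X : Set M} (hX : (graphDom h ∪ X).encard ≤ k) :
    ∃ h' : Set (M × N), h ⊆ h' ∧ IsCollapsible S W h' ∧ X ⊆ graphDom h' := by
  obtain ⟨h', h₁, h₂, h₃, h₄⟩ := (hW h hh).2.1 _ Set.subset_union_left hX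
  exact ⟨h', h₁, ⟨h₃, by rwa [h₂]⟩, h₂ ▸ Set.subset_union_right⟩

/-- If `φ` held at the image, Spoiler could collapse to the guard, switch, and extend by witnesses
for `φ`; preservation in the opposite direction would then give `φ` at the original tuple. This is
why the hypothesis on `φ` has `W` and `W'` interchanged. -/
theorem HasWitnesses.guardedNot {k : ℕ} {S : Set (RelSymb L)} {W : Set (Set (M × N))}
    {W' : Set (Set (N × M))} (hW : BGNClosed k S S W W') (hW' : BGNClosed k S S W' W)
    {α φ : FPFormula L} (hα : α.IsGuard) (hS : α.rels ⊆ S) (hfree : φ.freeVars ⊆ α.freeVars)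
    (hk : α.size + φ.size ≤ k) (hφ : HasWitnesses S W' W φ) :
    HasWitnesses S W W' (and α (not φ)) := by
  intro v V V' hV hv
  refine ⟨∅, by simp, fun h hh _ w hw => ⟨?_, fun hwφ => hv.2 ?_⟩⟩
  · exact realize_of_isGuard hα hS hh.1 (fun x hx => hw x (Or.inl hx)) hv.1
  have hwα : α.Realize w V' := realize_of_isGuard hα hS hh.1 (fun x hx => hw x (Or.inl hx)) hv.1
  have hY : v '' α.freeVars ⊆ graphDom h := by
    rintro _ ⟨x, hx, rfl⟩
    exact ⟨_, hw x (Or.inl hx), rfl⟩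
  have hgY := strictlyGuarded_of_isGuard hα hS hv.1
  set g := graphRestrict h (v '' α.freeVars) with hg
  have hgW : g ∈ W := hh.2 _ hY hgY
  have hdom : graphDom g = v '' α.freeVars := graphDom_graphRestrict hY
  have hinv : ∀ x ∈ α.freeVars, (w x, v x) ∈ graphInv g := fun x hx =>
    ⟨(v x, w x), ⟨hw x (Or.inl hx), x, hx, rfl⟩, rfl⟩
  obtain ⟨hiso, hcol⟩ := (hW g hgW).2.2 (hdom ▸ hgY)
  have hdom' : graphDom (graphInv g) = w '' α.freeVars := by
    apply Set.Subset.antisymm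
    · rintro _ ⟨_, ⟨⟨a, b⟩, hp, rfl⟩, rfl⟩
      obtain ⟨x, hx, e⟩ : a ∈ v '' α.freeVars := hp.2
      refine ⟨x, hx, hh.1.1 _ _ _ (hw x (Or.inl hx)) ?_⟩
      rw [e]; exact hp.1
    · rintro _ ⟨x, hx, rfl⟩
      exact ⟨_, hinv x hx, rfl⟩
  -- The guard also holds on the image side, so the collapse after the switch may keep the whole
  -- domain.
  have hgW' : graphInv g ∈ W' := by
    have := hcol _ Set.Subset.rfl (hdom' ▸ strictlyGuarded_of_isGuard hα hS hwα)
    convert this using 1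
    ext p
    exact ⟨fun hp => ⟨hp, p, hp, rfl⟩, fun hp => hp.1⟩
  obtain ⟨X, hX, hXφ⟩ := hφ w V' V (by
    intro n Z
    have := hV n Z
    exact ⟨fun hn => this.2 fun hn' => hn hn'.2, fun hn => this.1 fun hn' => hn hn'.2⟩) hwφ
  obtain ⟨h', hsub, hcol', hdX⟩ := isCollapsible_of_bgnClosed hW' hgW' (X := X) (by
    rw [hdom']
    refine (Set.encard_union_le _ _).trans ?_
    refine (add_le_add (encard_image_freeVars_le hα w) hX).trans ?_
    exact_mod_cast hk)
  exact hXφ h' hcol' hdX v fun x hx => hsub (hinv x (hfree hx))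

theorem range_eq_image_extend {n : ℕ} {x : Fin n → ℕ} (hx : Function.Injective x) (a : Fin n → M)
    (v : ℕ → M) : Function.extend x a v '' Set.range x = Set.range a := by
  rw [← Set.range_comp]
  congr 1
  exact Function.extend_comp hx a v

/-- Any prefixpoint in `N` is pulled back along the positions in `W` to a prefixpoint in `M`, which
then contains the given tuple. No witnesses are needed up front: each unfolding of the fixpoint
starts from a fresh position on a guarded tuple. -/
theorem HasWitnesses.lfp {k : ℕ} {S : Set (RelSymb L)} {W : Set (Set (M × N))}
    {W' : Set (Set (N × M))} (hW : BGNClosed k S S W W') {n : ℕ} (X : ℕ) {x : Fin n → ℕ}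
    {α φ : FPFormula L} (y : Fin n → ℕ) (hx : Function.Injective x) (hα : α.IsGuard)
    (hS : α.rels ⊆ S) (hαx : α.freeVars = Set.range x) (hfree : φ.freeVars ⊆ Set.range x)
    (hpol : φ.HasPolarity (n, X) true) (hk : φ.size + n ≤ k) (hφ : HasWitnesses S W W' φ) :
    HasWitnesses S W W' (lfp X x (and α φ) y) := by
  intro v V V' hV hv
  refine ⟨∅, by simp, fun h hh _ w hw U' hU' => ?_⟩
  -- The largest set that satisfies `SOForward` with respect to `U'`.
  let U : Set (Fin n → M) := {a | StrictlyGuarded S (Set.range a) ∧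
    ∀ h ∈ W, ∀ b : Fin n → N, (∀ i, (a i, b i) ∈ h) → b ∈ U'}
  have hU : (fun i => v (y i)) ∈ U := by
    refine hv U fun a ha => ?_
    have hga : StrictlyGuarded S (Set.range a) := by
      have := strictlyGuarded_of_isGuard hα hS ha.1
      rwa [hαx, range_eq_image_extend hx] at this
    refine ⟨hga, fun h₁ hh₁ b hb => hU' ⟨?_, ?_⟩⟩
    · refine realize_of_isGuard hα hS (hW h₁ hh₁).1.1 ?_ ha.1
      rw [hαx]
      rintro _ ⟨i, rfl⟩
      rw [hx.extend_apply, hx.extend_apply]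
      exact hb i
    · obtain ⟨X', hX', hXφ⟩ := hφ (Function.extend x a v)
        (Function.update V n (Function.update (V n) X U))
        (Function.update V' n (Function.update (V' n) X U')) (by
          intro m Z
          by_cases e : (m, Z) = (n, X)
          · obtain ⟨rfl, rfl⟩ := Prod.ext_iff.1 e
            -- `X` has no negative occurrence, so nothing is required from `U'` back to `U`.
            refine ⟨fun _ => ?_, fun h => absurd hpol h⟩
            simp only [Function.update_self]
            exact fun a ha => ha
          · have e' : Function.update V n (Function.update (V n) X U) m Z = V m Z := by
              by_cases hm : m = n
              · subst hm
                have hZ : Z ≠ X := fun hZ => e (by rw [hZ])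
                simp [hZ]
              · simp [hm]
            have e'' : Function.update V' n (Function.update (V' n) X U') m Z = V' m Z := by
              by_cases hm : m = n
              · subst hm
                have hZ : Z ≠ X := fun hZ => e (by rw [hZ])
                simp [hZ]
              · simp [hm]
            rw [e', e'']
            have e₁ : ¬ (n, X) = (m, Z) := fun h => e h.symm
            exact ⟨fun hn => (hV m Z).1 fun h => (h.resolve_left e₁).2 |> hn,
              fun hn => (hV m Z).2 fun h => (h.resolve_left e₁).2 |> hn⟩) ha.2
      have hsubdom : Set.range a ⊆ graphDom h₁ := by
        rintro _ ⟨i, rfl⟩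
        exact ⟨_, hb i, rfl⟩
      -- The domain of `h₁` may already have `k` elements. A trivial extension followed by a
      -- collapse to the at most `n` elements of `a` makes room for the witnesses `X'`.
      have hcol₁ := isCollapsible_of_bgnClosed hW hh₁ (X := ∅)
        (by rw [Set.union_empty]; exact (hW h₁ hh₁).1.2)
      obtain ⟨h₂, h₁₂, hcol₂, -⟩ := hcol₁
      have hsub₂ : Set.range a ⊆ graphDom h₂ := by
        rintro _ ⟨i, rfl⟩
        exact ⟨_, h₁₂ (hb i), rfl⟩
      have hg := hcol₂.2 _ hsub₂ hga
      obtain ⟨h₃, h₂₃, hcol₃, hX₃⟩ := isCollapsible_of_bgnClosed hW hg (X := X') (by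
        rw [graphDom_graphRestrict hsub₂, add_comm] at *
        refine (Set.encard_union_le _ _).trans ?_
        have : (Set.range a).encard ≤ n := by
          rw [← Set.image_univ]
          refine (Set.encard_image_le _ _).trans ?_
          simp
        refine (add_le_add this hX').trans ?_
        exact_mod_cast hk)
      refine hXφ h₃ hcol₃ hX₃ _ fun z hz => ?_
      obtain ⟨i, rfl⟩ := hfree hz
      rw [hx.extend_apply, hx.extend_apply]
      exact h₂₃ ⟨h₁₂ (hb i), i, rfl⟩
  have hdom : Set.range (fun i => v (y i)) ⊆ graphDom h := by
    rintro _ ⟨i, rfl⟩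
    exact ⟨_, hw _ (Or.inr ⟨i, rfl⟩), rfl⟩
  exact hU.2 _ (hh.2 _ hdom hU.1) _ fun i => ⟨hw _ (Or.inr ⟨i, rfl⟩), i, rfl⟩

/-- Guarded negation fixpoint formulas are preserved along winning regions of Duplicator. -/
theorem IsGNFP.hasWitnesses {k : ℕ} {S : Set (RelSymb L)} {φ : FPFormula L} (hφ : φ.IsGNFP)
    (hS : φ.rels ⊆ S) (hk : φ.size ≤ k) {M N : Type u} [L.Structure M] [L.Structure N]
    {W : Set (Set (M × N))} {W' : Set (Set (N × M))}
    (hW : BGNClosed k S S W W') (hW' : BGNClosed k S S W' W) : HasWitnesses S W W' φ := by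
  -- Negation exchanges the two structures, so the induction hypothesis must hold for all pairs.
  induction hφ generalizing M N with
  | rel R x =>
    intro v V V' _ hv
    exact ⟨∅, by simp, fun h hh _ w hw => realize_of_isGuard (.rel R x) hS hh.1 hw hv⟩
  | eq x y =>
    intro v V V' _ hv
    exact ⟨∅, by simp, fun h hh _ w hw => realize_of_isGuard (.eq x y) hS hh.1 hw hv⟩
  | so X x =>
    intro v V V' hV hv
    refine ⟨∅, by simp, fun h hh _ w hw => ?_⟩
    -- Tuples of a second-order variable are strictly guarded, so `h` can be collapsed to a position
    -- in `W` on this tuple.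
    obtain ⟨hg, hf⟩ := (hV _ X).1 (fun h => Bool.false_ne_true (h rfl)) _ hv
    refine hf _ (hh.2 _ ?_ hg) _ fun i => ⟨hw _ ⟨i, rfl⟩, i, rfl⟩
    rintro _ ⟨i, rfl⟩
    exact ⟨_, hw _ ⟨i, rfl⟩, rfl⟩
  | @and φ ψ _ _ h₁ h₂ =>
    intro v V V' hV hv
    have hk : φ.size + ψ.size ≤ k := hk
    obtain ⟨X₁, hX₁, hr₁⟩ := h₁ (fun _ h => hS (Or.inl h)) (by omega) hW hW' v V V'
      (fun n X => ⟨fun h => (hV n X).1 fun h' => h h'.1, fun h => (hV n X).2 fun h' => h h'.1⟩) hv.1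
    obtain ⟨X₂, hX₂, hr₂⟩ := h₂ (fun _ h => hS (Or.inr h)) (by omega) hW hW' v V V'
      (fun n X => ⟨fun h => (hV n X).1 fun h' => h h'.2, fun h => (hV n X).2 fun h' => h h'.2⟩) hv.2
    refine ⟨X₁ ∪ X₂, (Set.encard_union_le _ _).trans ?_, fun h hh hX w hw =>
      ⟨hr₁ h hh (Set.subset_union_left.trans hX) w fun x hx => hw x (Or.inl hx),
        hr₂ h hh (Set.subset_union_right.trans hX) w fun x hx => hw x (Or.inr hx)⟩⟩
    simpa [size] using add_le_add hX₁ hX₂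
  | @or φ ψ _ _ h₁ h₂ =>
    intro v V V' hV hv
    have hk : φ.size + ψ.size ≤ k := hk
    rcases hv with hv | hv
    · obtain ⟨X₁, hX₁, hr₁⟩ := h₁ (fun _ h => hS (Or.inl h)) (by omega) hW hW' v V V'
        (fun n X => ⟨fun h => (hV n X).1 fun h' => h h'.1, fun h => (hV n X).2 fun h' => h h'.1⟩) hv
      refine ⟨X₁, hX₁.trans ?_, fun h hh hX w hw =>
        Or.inl (hr₁ h hh hX w fun x hx => hw x (Or.inl hx))⟩
      simp [size]
    · obtain ⟨X₂, hX₂, hr₂⟩ := h₂ (fun _ h => hS (Or.inr h)) (by omega) hW hW' v V V'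
        (fun n X => ⟨fun h => (hV n X).1 fun h' => h h'.2, fun h => (hV n X).2 fun h' => h h'.2⟩) hv
      refine ⟨X₂, hX₂.trans ?_, fun h hh hX w hw =>
        Or.inr (hr₂ h hh hX w fun x hx => hw x (Or.inr hx))⟩
      simp [size]
  | @ex x φ _ ih =>
    intro v V V' hV ⟨a, ha⟩
    have hk : φ.size + 1 ≤ k := hk
    obtain ⟨X, hX, hr⟩ := ih hS (by omega) hW hW' _ V V' hV ha
    refine ⟨insert a X, (Set.encard_insert_le _ _).trans ?_, fun h hh hXh w hw => ?_⟩
    · simpa [size] using add_le_add_left hX 1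
    · obtain ⟨⟨a', b⟩, hab, e⟩ := hXh (Set.mem_insert a X)
      obtain rfl : a' = a := e
      refine ⟨b, hr h hh ((Set.subset_insert _ _).trans hXh) _ fun z hz => ?_⟩
      by_cases e : z = x
      · subst e; simpa using hab
      · simpa [e] using hw z ⟨hz, e⟩
  | @guardedNot α φ hα _ hfree ih =>
    have hk : α.size + φ.size ≤ k := hk
    exact .guardedNot hW hW' hα (fun _ h => hS (Or.inl h)) hfree hk
      (ih (fun _ h => hS (Or.inr h)) (by omega) hW' hW)
  | @lfp n X x α φ y hx hα hαx _ hfree hpol ih =>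
    have hk : α.size + φ.size + n ≤ k := hk
    exact .lfp hW X y hx hα (fun _ h => hS (Or.inl h)) hαx hfree hpol (by omega)
      (ih (fun _ h => hS (Or.inr h)) (by omega) hW hW')

theorem finite_freeVars (φ : FPFormula L) : φ.freeVars.Finite := by
  induction φ with
  | rel R x => exact Set.finite_range x
  | eq x y => exact Set.toFinite ({x, y} : Set ℕ)
  | so X x => exact Set.finite_range x
  | and φ ψ h₁ h₂ | or φ ψ h₁ h₂ => exact h₁.union h₂
  | not φ ih => exact ih
  | ex x φ ih => exact ih.sdiff
  | lfp X x φ y ih => exact ih.sdiff.union (Set.finite_range y)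

/-- A guarded negation fixpoint formula without free second-order variables that is satisfiable in
`M` is satisfiable in every structure that is bisimilar to `M` for a sufficiently large width. -/
theorem IsGNFP.exists_realize_of_bgnBisimilar {S : Set (RelSymb L)} {φ : FPFormula L}
    (hφ : φ.IsGNFP) (hS : φ.rels ⊆ S) (hso : φ.freeSOVars = ∅) :
    ∃ k : ℕ, ∀ (M N : Type u) [L.Structure M] [L.Structure N] [Nonempty N],
      BGNBisimilar M N k S S → ∀ (v : ℕ → M) (V : (n : ℕ) → ℕ → Set (Fin n → M))
        (V' : (n : ℕ) → ℕ → Set (Fin n → N)), φ.Realize v V → ∃ w : ℕ → N, φ.Realize w V' := by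
  classical
  -- From the empty position, one extension must cover the witnesses and the values of the free
  -- variables; `w` is then read off from Duplicator's answer.
  refine ⟨φ.size + φ.freeVars.ncard, fun M N _ _ _ ⟨W, W', h0, hW, hW'⟩ v V V' hv => ?_⟩
  obtain ⟨X, hX, hr⟩ := hφ.hasWitnesses hS (Nat.le_add_right _ _) hW hW' v V V'
    (fun n Z => by
      have := hasPolarity_of_notMem_freeSOVars (Z := (n, Z)) φ (by simp [hso])
      exact ⟨fun h => absurd (this _) h, fun h => absurd (this _) h⟩) hv
  obtain ⟨h, -, hcol, hXh⟩ := isCollapsible_of_bgnClosed hW h0 (X := X ∪ v '' φ.freeVars) (by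
    have : graphDom (∅ : Set (M × N)) = ∅ := by simp [graphDom]
    rw [this, Set.empty_union]
    refine (Set.encard_union_le _ _).trans ?_
    push_cast
    refine add_le_add hX ((Set.encard_image_le _ _).trans ?_)
    rw [φ.finite_freeVars.cast_ncard_eq])
  have : ∀ x, ∃ b : N, x ∈ φ.freeVars → (v x, b) ∈ h := by
    intro x
    by_cases hx : x ∈ φ.freeVars
    · obtain ⟨⟨a, b⟩, hab, e⟩ := hXh (Or.inr ⟨x, hx, rfl⟩)
      obtain rfl : a = v x := e
      exact ⟨b, fun _ => hab⟩
    · exact ⟨Classical.arbitrary N, fun h => absurd h hx⟩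
  choose w hw using this
  exact ⟨w, hr h hcol (Set.subset_union_left.trans hXh) w hw⟩

/-- Realization is invariant under isomorphisms. -/
theorem realize_equiv {M : Type*} {N : Type*} [L.Structure M] [L.Structure N] (e : M ≃ N)
    (he : ∀ (n : ℕ) (R : L.Relations n) (a : Fin n → M),
      FirstOrder.Language.Structure.RelMap R (e ∘ a) ↔ FirstOrder.Language.Structure.RelMap R a)
    (φ : FPFormula L) (v : ℕ → M) (V : (n : ℕ) → ℕ → Set (Fin n → N)) :
    φ.Realize (e ∘ v) V ↔ φ.Realize v (fun n X => {a | e ∘ a ∈ V n X}) := by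
  induction φ generalizing v V with
  | rel R x => exact he _ R _
  | eq x y => exact e.apply_eq_iff_eq
  | so X x => exact Iff.rfl
  | and φ ψ h₁ h₂ => exact and_congr (h₁ v V) (h₂ v V)
  | or φ ψ h₁ h₂ => exact or_congr (h₁ v V) (h₂ v V)
  | not φ ih => exact not_congr (ih v V)
  | ex x φ ih =>
    simp only [Realize]
    rw [← e.exists_congr_right]
    refine exists_congr fun a => ?_
    rw [← ih, Function.comp_update]
  | @lfp n X x φ y ih =>
    have key : ∀ (a : Fin n → M) (U : Set (Fin n → N)),
        φ.Realize (Function.extend x (e ∘ a) (e ∘ v))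
          (Function.update V n (Function.update (V n) X U)) ↔
        φ.Realize (Function.extend x a v)
          (Function.update (fun n X => {a | e ∘ a ∈ V n X}) n
            (Function.update (fun X => {a | e ∘ a ∈ V n X}) X {a | e ∘ a ∈ U})) := by
      intro a U
      have h₁ : Function.extend x (e ∘ a) (e ∘ v) = e ∘ Function.extend x a v := by
        funext z
        by_cases hz : ∃ i, x i = z
        · simp [Function.extend, hz]
        · simp [Function.extend, hz]
      rw [h₁, ih]
      have h₂ : (fun m Z => {a : Fin m → M | e ∘ a ∈
            Function.update V n (Function.update (V n) X U) m Z}) =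
          Function.update (fun n X => {a : Fin n → M | e ∘ a ∈ V n X}) n
            (Function.update (fun X => {a : Fin n → M | e ∘ a ∈ V n X}) X {a | e ∘ a ∈ U}) := by
        funext m Z
        by_cases hm : m = n
        · subst hm
          by_cases hZ : Z = X
          · subst hZ; simp
          · simp [hZ]
        · simp [hm]
      rw [h₂]
    have hcancel : ∀ b : Fin n → N, e ∘ (e.symm ∘ b) = b := fun b => by
      funext i; simp
    constructor
    · intro h U hU
      have := h {b | e.symm ∘ b ∈ U} fun b hb => by
        refine hU ?_
        have hb : φ.Realize (Function.extend x b (e ∘ v)) _ := hb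
        rw [← hcancel b, key] at hb
        have hpre : {a : Fin n → M | e ∘ a ∈ {b : Fin n → N | e.symm ∘ b ∈ U}} = U := by
          ext a
          have : e.symm ∘ (e ∘ a) = a := by funext i; simp
          simp [this]
        rw [hpre] at hb
        exact hb
      have e' : e.symm ∘ (fun i => (e ∘ v) (y i)) = fun i => v (y i) := by funext i; simp
      rw [← e']
      exact this
    · intro h U hU
      refine h {a | e ∘ a ∈ U} fun a ha => hU ?_
      exact (key a U).2 ha

end Invariance

end FPFormula

/-! ### The game on directed graphs -/

section GraphBisimulation

open FirstOrder.Language.Structure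

/-- The `Q,R`-reduct of `M` is the directed graph with edge relation `E`, and all its elements
satisfy `Q`. -/
structure IsGraphReduct {M : Type*} [lassoLang.Structure M] (E : M → M → Prop) : Prop where
  edge : ∀ a : Fin 2 → M, RelMap (L := lassoLang) LassoRel.R a ↔ E (a 0) (a 1)
  univ : ∀ a : Fin 1 → M, RelMap (L := lassoLang) LassoRel.Q a

/-- The graph has no loops, and no directed cycles of length two, if `k` elements suffice to
exhibit one. -/
def NoShortCycles {M : Type*} (k : ℕ) (E : M → M → Prop) : Prop :=
  (1 ≤ k → ∀ a, ¬ E a a) ∧ (2 ≤ k → ∀ a b, E a b → ¬ E b a)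

variable {M : Type*} {N : Type*} [lassoLang.Structure M] [lassoLang.Structure N]
  {E : M → M → Prop} {F : N → N → Prop}

theorem IsGraphReduct.isPartialHom_iff (hE : IsGraphReduct E) (hF : IsGraphReduct F)
    {h : Set (M × N)} : IsPartialHom {symbQ, symbR} h ↔
      (∀ a b b', (a, b) ∈ h → (a, b') ∈ h → b = b') ∧
      ∀ a b a' b', (a, b) ∈ h → (a', b') ∈ h → E a a' → F b b' := by
  refine and_congr_right fun _ => ⟨fun H a b a' b' h₁ h₂ hab => ?_, fun H n r hr' a b hab hr => ?_⟩
  · have := H 2 LassoRel.R (Or.inr rfl) ![a, a'] ![b, b']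
      (by intro i; fin_cases i; exacts [h₁, h₂]) ((hE.edge _).2 hab)
    exact (hF.edge _).1 this
  · rcases hr' with hr' | hr'
    · cases hr'
      exact hF.univ b
    · cases hr'
      exact (hF.edge _).2 (H _ _ _ _ (hab 0) (hab 1) ((hE.edge _).1 hr))

theorem IsGraphReduct.strictlyGuarded_iff (hE : IsGraphReduct E) {Y : Set M} :
    StrictlyGuarded {symbQ, symbR} Y ↔ Y = ∅ ∨ (∃ a, Y = {a}) ∨ ∃ a a', E a a' ∧ Y = {a, a'} := by
  refine or_congr_right ⟨?_, ?_⟩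
  · rintro (h | ⟨n, r, a, hR | hR, hr, rfl⟩)
    · exact Or.inl h
    · cases hR
      refine Or.inl ⟨a 0, ?_⟩
      ext x
      simp [eq_comm]
    · cases hR
      refine Or.inr ⟨a 0, a 1, (hE.edge _).1 hr, ?_⟩
      ext x
      simp [eq_comm]
  · rintro (h | ⟨a, a', haa', rfl⟩)
    · exact Or.inl h
    · refine Or.inr ⟨2, LassoRel.R, ![a, a'], Or.inr rfl, (hE.edge _).2 haa', ?_⟩
      ext x
      simp [eq_comm, or_comm]

theorem IsGraphReduct.edge_of_strictlyGuarded (hE : IsGraphReduct E) {Y : Set M}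
    (hY : StrictlyGuarded {symbQ, symbR} Y) {a a' : M} (ha : a ∈ Y) (ha' : a' ∈ Y) (hne : a ≠ a') :
    E a a' ∨ E a' a := by
  rcases hE.strictlyGuarded_iff.1 hY with rfl | ⟨b, rfl⟩ | ⟨b, b', hb, rfl⟩
  · exact ha.elim
  · exact absurd (ha.trans ha'.symm) hne
  · rcases ha with rfl | rfl <;> rcases ha' with rfl | rfl
    · exact absurd rfl hne
    · exact Or.inl hb
    · exact Or.inr hb
    · exact absurd rfl hne

variable (M N) in
/-- The partial homomorphisms with a strictly guarded domain of at most `k` elements. -/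
def guardedPositions (k : ℕ) : Set (Set (M × N)) :=
  {h | IsPartialHom {symbQ, symbR} h ∧ StrictlyGuarded {symbQ, symbR} (graphDom h) ∧
    (graphDom h).encard ≤ k}

theorem graphRestrict_mem_guardedPositions {k : ℕ} {h : Set (M × N)}
    (hh : IsPartialHom {symbQ, symbR} h) (hk : (graphDom h).encard ≤ k) {Y : Set M}
    (hY : Y ⊆ graphDom h) (hg : StrictlyGuarded {symbQ, symbR} Y) :
    graphRestrict h Y ∈ guardedPositions M N k := by
  refine ⟨⟨fun a b b' h₁ h₂ => hh.1 a b b' h₁.1 h₂.1,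
    fun n r hr a b hab => hh.2 n r hr a b fun i => (hab i).1⟩, ?_, ?_⟩
  · rwa [graphDom_graphRestrict hY]
  · rw [graphDom_graphRestrict hY]
    exact (Set.encard_le_encard hY).trans hk

/-- Only extend moves need an argument for the particular graphs. Switches are harmless: a guarded
domain is at most the two ends of an edge, and a homomorphism on it is an isomorphism unless the
target has a loop or a cycle of length two. -/
theorem bgnClosed_guardedPositions {k : ℕ} (hE : IsGraphReduct E) (hF : IsGraphReduct F)
    (hF' : NoShortCycles k F)
    (ext : ∀ X : Set M, X.encard ≤ k → ∀ h ∈ guardedPositions M N k, graphDom h ⊆ X →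
      ∃ f : M → N, (∀ p ∈ h, f p.1 = p.2) ∧ ∀ a ∈ X, ∀ a' ∈ X, E a a' → F (f a) (f a')) :
    BGNClosed k {symbQ, symbR} {symbQ, symbR} (guardedPositions M N k)
      (guardedPositions N M k) := by
  intro h hh
  refine ⟨⟨hh.1, hh.2.2⟩, fun X hX hk => ?_, fun hg => ?_⟩
  · obtain ⟨f, hf, hfE⟩ := ext X hk h hh hX
    have hdom : graphDom ((fun a => (a, f a)) '' X) = X := by
      simp [graphDom, Set.image_image]
    have hhom : IsPartialHom {symbQ, symbR} ((fun a => (a, f a)) '' X) := by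
      refine (hE.isPartialHom_iff hF).2 ⟨?_, ?_⟩
      · rintro _ _ _ ⟨a, _, e⟩ ⟨a', _, e'⟩
        simp only [Prod.mk.injEq] at e e'
        rw [← e.2, ← e'.2, e.1, e'.1]
      · rintro _ _ _ _ ⟨a, ha, e⟩ ⟨a', ha', e'⟩ haa'
        simp only [Prod.mk.injEq] at e e'
        rw [← e.2, ← e'.2]
        exact hfE _ ha _ ha' (by rwa [e.1, e'.1])
    refine ⟨(fun a => (a, f a)) '' X, fun p hp => ⟨p.1, hX ⟨p, hp, rfl⟩, ?_⟩, hdom, hhom,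
      fun Y hY hYg => graphRestrict_mem_guardedPositions hhom (by rwa [hdom]) (by rwa [hdom]) hYg⟩
    exact Prod.ext rfl (hf p hp)
  · obtain ⟨hfun, hedge⟩ := (hE.isPartialHom_iff hF).1 hh.1
    -- `NoShortCycles` excludes cycles only for large enough `k`; the size of the domain supplies
    -- the bound.
    have one_le : ∀ {a}, a ∈ graphDom h → 1 ≤ k := fun {a} ha => by
      have := (Set.encard_le_encard (Set.singleton_subset_iff.2 ha)).trans hh.2.2
      rw [Set.encard_singleton] at this
      exact_mod_cast this
    have two_le : ∀ {a a'}, a ∈ graphDom h → a' ∈ graphDom h → a ≠ a' → 2 ≤ k :=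
      fun {a a'} ha ha' hne => by
        have := (Set.encard_le_encard (Set.pair_subset ha ha')).trans hh.2.2
        rw [Set.encard_pair hne] at this
        exact_mod_cast this
    -- Identifying the ends of an edge would produce a loop in the target.
    have hinj : ∀ a a' b, (a, b) ∈ h → (a', b) ∈ h → a = a' := by
      intro a a' b h₁ h₂
      by_contra hne
      have hk := one_le ⟨_, h₁, rfl⟩
      rcases hE.edge_of_strictlyGuarded hg ⟨_, h₁, rfl⟩ ⟨_, h₂, rfl⟩ hne with he | he
      · exact hF'.1 hk _ (hedge _ _ _ _ h₁ h₂ he)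
      · exact hF'.1 hk _ (hedge _ _ _ _ h₂ h₁ he)
    have hinv : IsPartialHom {symbQ, symbR} (graphInv h) := by
      refine (hF.isPartialHom_iff hE).2 ⟨?_, ?_⟩
      · rintro _ _ _ ⟨⟨a, b⟩, h₁, e⟩ ⟨⟨a', b'⟩, h₂, e'⟩
        simp only [Prod.swap_prod_mk, Prod.mk.injEq] at e e'
        rw [← e.2, ← e'.2]
        refine hinj a a' b h₁ ?_
        rwa [e.1, ← e'.1]
      · rintro _ _ _ _ ⟨⟨a, b⟩, h₁, e⟩ ⟨⟨a', b'⟩, h₂, e'⟩ hbb'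
        simp only [Prod.swap_prod_mk, Prod.mk.injEq] at e e'
        rw [← e.1, ← e'.1] at hbb'
        rw [← e.2, ← e'.2]
        have hk := one_le ⟨_, h₁, rfl⟩
        have hne : a ≠ a' := by
          rintro rfl
          rw [hfun _ _ _ h₁ h₂] at hbb'
          exact hF'.1 hk _ hbb'
        -- An edge the other way would be mapped to the reverse of `hbb'`, giving a cycle of length
        -- two.
        refine (hE.edge_of_strictlyGuarded hg ⟨_, h₁, rfl⟩ ⟨_, h₂, rfl⟩ hne).resolve_right
          fun he => ?_
        exact hF'.2 (two_le ⟨_, h₁, rfl⟩ ⟨_, h₂, rfl⟩ hne) _ _ hbb' (hedge _ _ _ _ h₂ h₁ he)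
    refine ⟨⟨hh.1, hinv⟩, fun Y hY hYg => graphRestrict_mem_guardedPositions hinv ?_ hY hYg⟩
    have hcard : h.encard = (graphDom h).encard := by
      refine (Set.InjOn.encard_image ?_).symm
      rintro ⟨a, b⟩ h₁ ⟨a', b'⟩ h₂ e
      obtain rfl : a = a' := e
      rw [hfun _ _ _ h₁ h₂]
    refine (Set.encard_image_le _ _).trans ((Set.encard_image_le _ _).trans ?_)
    rw [hcard]
    exact hh.2.2

/-- The three kinds of positions with a strictly guarded domain. -/
theorem guardedPositions_cases {k : ℕ} (hE : IsGraphReduct E) (hF : IsGraphReduct F)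
    {h : Set (M × N)} (hh : h ∈ guardedPositions M N k) :
    h = ∅ ∨ (∃ a b, h = {(a, b)}) ∨
      ∃ a a' b b', E a a' ∧ F b b' ∧ h = {(a, b), (a', b')} := by
  obtain ⟨hfun, hedge⟩ := (hE.isPartialHom_iff hF).1 hh.1
  rcases hE.strictlyGuarded_iff.1 hh.2.1 with hd | ⟨a, hd⟩ | ⟨a, a', haa', hd⟩
  · exact Or.inl (Set.image_eq_empty.1 hd)
  · obtain ⟨⟨a₁, b⟩, h₁, e₁⟩ : a ∈ graphDom h := hd ▸ rfl
    obtain rfl : a₁ = a := e₁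
    refine Or.inr (Or.inl ⟨a₁, b, Set.Subset.antisymm ?_ (by simpa using h₁)⟩)
    rintro ⟨a, b'⟩ hp
    obtain rfl : a = a₁ := by
      have : a ∈ graphDom h := ⟨_, hp, rfl⟩
      rwa [hd] at this
    rw [hfun _ _ _ hp h₁]
    rfl
  · obtain ⟨⟨a₁, b⟩, h₁, e₁⟩ : a ∈ graphDom h := hd ▸ Or.inl rfl
    obtain rfl : a₁ = a := e₁
    obtain ⟨⟨a₂, b'⟩, h₂, e₂⟩ : a' ∈ graphDom h := hd ▸ Or.inr rfl
    obtain rfl : a₂ = a' := e₂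
    refine Or.inr (Or.inr ⟨a₁, a₂, b, b', haa', hedge _ _ _ _ h₁ h₂ haa',
      Set.Subset.antisymm ?_ (by rintro _ (rfl | rfl); exacts [h₁, h₂])⟩)
    rintro ⟨a, c⟩ hp
    have : a ∈ graphDom h := ⟨_, hp, rfl⟩
    rw [hd] at this
    rcases this with rfl | rfl
    · exact Or.inl (by rw [hfun _ _ _ hp h₁])
    · exact Or.inr (by rw [hfun _ _ _ hp h₂]; rfl)

end GraphBisimulation

/-! ### Maps between the single loop and the double lasso -/

section Loops

theorem SingleLoop.isGraphReduct (k : ℕ) : IsGraphReduct (SingleLoop.Edge (k := k)) :=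
  ⟨fun _ => Iff.rfl, fun _ => trivial⟩

theorem DoubleLasso.isGraphReduct (k : ℕ) : IsGraphReduct (DoubleLasso.Edge (k := k)) :=
  ⟨fun _ => Iff.rfl, fun _ => trivial⟩

theorem Fin.add_one_ne_self' {k : ℕ} (hk : 1 ≤ k) (i : Fin (k + 1)) : i ≠ i + 1 := by
  obtain ⟨k, rfl⟩ := Nat.exists_eq_add_of_le' hk
  intro h
  simp at h

theorem Fin.add_one_add_one_ne_self {k : ℕ} (hk : 2 ≤ k) (i : Fin (k + 1)) : i ≠ i + 1 + 1 := by
  obtain ⟨k, rfl⟩ := Nat.exists_eq_add_of_le' hk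
  intro h
  have h : (1 + 1 : Fin (k + 2 + 1)) = 0 := by
    refine left_eq_add.1 (h.trans (add_assoc _ _ _))
  have := congrArg Fin.val h
  simp [Fin.val_add, Nat.mod_eq_of_lt] at this

theorem SingleLoop.noShortCycles (k : ℕ) : NoShortCycles k (SingleLoop.Edge (k := k)) := by
  refine ⟨fun hk a h => Fin.add_one_ne_self' hk a h, fun hk a b h h' => ?_⟩
  have h : b = (show Fin (k + 1) from a) + 1 := h
  have h' : a = (show Fin (k + 1) from b) + 1 := h'
  subst h
  exact Fin.add_one_add_one_ne_self hk a h'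

/-- The homomorphism from the double lasso that wraps it around the single loop. -/
def DoubleLasso.wrap {k : ℕ} : DoubleLasso k → Fin (k + 1)
  | first i => i
  | mid => 1
  | last i => i + (1 + 1)

theorem DoubleLasso.wrap_edge {k : ℕ} {a b : DoubleLasso k} (h : Edge a b) :
    wrap b = wrap a + 1 := by
  cases h with
  | firstLoop i => rfl
  | firstMid => simp [wrap]
  | midLast => simp [wrap]
  | lastLoop i => simp only [wrap]; abel

/-- `wrap` would carry a short cycle to a short closed walk in the single loop. -/
theorem DoubleLasso.noShortCycles (k : ℕ) : NoShortCycles k (DoubleLasso.Edge (k := k)) := by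
  refine ⟨fun hk a h => Fin.add_one_ne_self' hk _ (wrap_edge h), fun hk a b h h' => ?_⟩
  have := wrap_edge h'
  rw [wrap_edge h] at this
  exact Fin.add_one_add_one_ne_self hk _ this

theorem DoubleLasso.exists_edge {k : ℕ} (a : DoubleLasso k) : ∃ b, Edge a b := by
  cases a with
  | first i => exact ⟨_, .firstLoop i⟩
  | mid => exact ⟨_, .midLast⟩
  | last i => exact ⟨_, .lastLoop i⟩

theorem DoubleLasso.exists_edge_to {k : ℕ} (a : DoubleLasso k) : ∃ b, Edge b a := by
  cases a with
  | first i => exact ⟨first (i - 1), by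
      have := Edge.firstLoop (i - 1)
      rwa [sub_add_cancel] at this⟩
  | mid => exact ⟨_, .firstMid⟩
  | last i => exact ⟨last (i - 1), by
      have := Edge.lastLoop (i - 1)
      rwa [sub_add_cancel] at this⟩

/-- In a graph in which every vertex has a successor and a predecessor, every edge lies on a
bi-infinite walk. -/
theorem exists_walk {D : Type*} {F : D → D → Prop} (succ : ∀ a, ∃ b, F a b)
    (pred : ∀ a, ∃ b, F b a) {a b : D} (hab : F a b) :
    ∃ w : ℤ → D, w 0 = a ∧ w 1 = b ∧ ∀ i, F (w i) (w (i + 1)) := by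
  choose s hs using succ
  choose p hp using pred
  refine ⟨fun i => match i with
    | .ofNat 0 => a
    | .ofNat (n + 1) => s^[n] b
    | .negSucc n => p^[n + 1] a, rfl, rfl, fun i => ?_⟩
  match i with
  | .ofNat 0 => exact hab
  | .ofNat (n + 1) =>
    change F (s^[n] b) (s^[n + 1] b)
    rw [Function.iterate_succ_apply']
    exact hs _
  | .negSucc 0 => exact hp _
  | .negSucc (n + 1) =>
    change F (p^[n + 1 + 1] a) (p^[n + 1] a)
    rw [Function.iterate_succ_apply' p (n + 1)]
    exact hp _

theorem SingleLoop.edge_iff {k : ℕ} {i j : Fin (k + 1)} : Edge (k := k) i j ↔ j = i + 1 := Iff.rfl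

/-- A proper subset of the loop can be mapped homomorphically to the double lasso, with prescribed
values on an edge. -/
theorem exists_map_of_encard_le {k : ℕ} (X : Set (Fin (k + 1))) (hX : X.encard ≤ k)
    (c : Fin (k + 1)) (b b' : DoubleLasso k) (hb : DoubleLasso.Edge b b') :
    ∃ f : Fin (k + 1) → DoubleLasso k, f c = b ∧ (c + 1 ∈ X → f (c + 1) = b') ∧
      ∀ a, a + 1 ∈ X → DoubleLasso.Edge (f a) (f (a + 1)) := by
  obtain ⟨m, hm⟩ : ∃ m, m ∉ X := by
    by_contra! hall
    rw [Set.eq_univ_of_forall hall, Set.encard_univ, ENat.card_eq_coe_fintype_card,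
      Fintype.card_fin] at hX
    have : k + 1 ≤ k := by exact_mod_cast hX
    omega
  -- Cut the loop open at the missing element `m`: `pos` is the distance from `m`, and only the edge
  -- into `m` fails to raise it by one.
  let pos : Fin (k + 1) → ℤ := fun a => ((a - m : Fin (k + 1)).val : ℤ)
  have hpos : ∀ a : Fin (k + 1), a + 1 ∈ X → pos (a + 1) = pos a + 1 := by
    intro a ha
    have hne : a + 1 ≠ m := by rintro e; exact hm (e ▸ ha)
    have hlast : a - m ≠ Fin.last k := by
      intro e
      apply hne
      have : a - m + 1 = 0 := by rw [e]; simp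
      rw [sub_add_eq_add_sub] at this
      exact sub_eq_zero.1 this
    have e : a + 1 - m = a - m + 1 := by rw [sub_add_eq_add_sub]
    simp only [pos, e]
    rw [Fin.val_add_one_of_lt (Fin.lt_last_iff_ne_last.2 hlast)]
    push_cast
    rfl
  obtain ⟨w, h0, h1, hw⟩ := exists_walk DoubleLasso.exists_edge DoubleLasso.exists_edge_to hb
  -- Lay the cut loop along the walk, shifted so that `c` sits at time `0`.
  refine ⟨fun a => w (pos a - pos c), by simpa using h0, fun hc => ?_, fun a ha => ?_⟩
  · simp only [hpos c hc, add_sub_cancel_left, h1]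
  · simp only [hpos a ha, add_sub_right_comm]
    exact hw _

theorem SingleLoop.exists_extension {k : ℕ} (X : Set (SingleLoop k)) (hX : X.encard ≤ k)
    (h : Set (SingleLoop k × DoubleLasso k)) (hh : h ∈ guardedPositions _ _ k)
    (hdom : graphDom h ⊆ X) :
    ∃ f : SingleLoop k → DoubleLasso k, (∀ p ∈ h, f p.1 = p.2) ∧
      ∀ a ∈ X, ∀ a' ∈ X, Edge a a' → DoubleLasso.Edge (f a) (f a') := by
  have hom : ∀ f : Fin (k + 1) → DoubleLasso k,
      (∀ a, (a + 1 : Fin (k + 1)) ∈ X → DoubleLasso.Edge (f a) (f (a + 1))) →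
      ∀ a ∈ X, ∀ a' ∈ X, Edge a a' → DoubleLasso.Edge (f a) (f a') := by
    intro f hf a _ a' ha' e
    cases edge_iff.1 e
    exact hf a ha'
  have key := exists_map_of_encard_le X hX
  rcases guardedPositions_cases (isGraphReduct k) (DoubleLasso.isGraphReduct k) hh with
    rfl | ⟨a, b, rfl⟩ | ⟨a, a', b, b', haa', hbb', rfl⟩
  · obtain ⟨f, -, -, hf⟩ := key 0 _ _ DoubleLasso.Edge.firstMid
    exact ⟨f, by simp, hom f hf⟩
  · obtain ⟨b', hb⟩ := DoubleLasso.exists_edge b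
    obtain ⟨f, h₁, -, hf⟩ := key a b b' hb
    exact ⟨f, by rintro _ rfl; exact h₁, hom f hf⟩
  · obtain ⟨f, h₁, h₂, hf⟩ := key a b b' hbb'
    refine ⟨f, ?_, hom f hf⟩
    rintro _ (rfl | rfl)
    · exact h₁
    · cases edge_iff.1 haa'
      exact h₂ (hdom ⟨_, Or.inr rfl, rfl⟩)

/-- `wrap` followed by a rotation is a global homomorphism with any prescribed value at one point.
On an edge the second value is then forced, because successors in the single loop are unique. -/
theorem DoubleLasso.exists_extension {k : ℕ} (h : Set (DoubleLasso k × SingleLoop k))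
    (hh : h ∈ guardedPositions _ _ k) :
    ∃ f : DoubleLasso k → SingleLoop k, (∀ p ∈ h, f p.1 = p.2) ∧
      ∀ a a', Edge a a' → SingleLoop.Edge (f a) (f a') := by
  have key : ∀ (a : DoubleLasso k) (b : Fin (k + 1)), ∃ f : DoubleLasso k → Fin (k + 1),
      f a = b ∧ ∀ a a', Edge a a' → f a' = f a + 1 := by
    intro a b
    refine ⟨fun c => wrap c + (b - wrap a), add_sub_cancel _ _, fun a a' e => ?_⟩
    simp only [wrap_edge e]
    abel
  rcases guardedPositions_cases (isGraphReduct k) (SingleLoop.isGraphReduct k) hh with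
    rfl | ⟨a, b, rfl⟩ | ⟨a, a', b, b', haa', hbb', rfl⟩
  · obtain ⟨f, -, hf⟩ := key mid 0
    exact ⟨f, by simp, hf⟩
  · obtain ⟨f, h₁, hf⟩ := key a b
    exact ⟨f, by rintro _ rfl; exact h₁, hf⟩
  · obtain ⟨f, h₁, hf⟩ := key a b
    refine ⟨f, ?_, hf⟩
    rintro _ (rfl | rfl)
    · exact h₁
    · refine (hf _ _ haa').trans ?_
      rw [h₁]
      exact hbb'.symm

theorem bgnBisimilar_singleLoop_doubleLasso (k : ℕ) :
    BGNBisimilar (SingleLoop k) (DoubleLasso k) k {symbQ, symbR} {symbQ, symbR} := by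
  refine ⟨_, _, ?_, bgnClosed_guardedPositions (SingleLoop.isGraphReduct k)
      (DoubleLasso.isGraphReduct k) (DoubleLasso.noShortCycles k)
      SingleLoop.exists_extension,
    bgnClosed_guardedPositions (DoubleLasso.isGraphReduct k) (SingleLoop.isGraphReduct k)
      (SingleLoop.noShortCycles k) fun X _ h hh _ => ?_⟩
  · refine ⟨⟨?_, ?_⟩, ?_, ?_⟩
    · simp
    · rintro n r (hR | hR) a b hab
      · cases hR; exact (hab 0).elim
      · cases hR; exact (hab 0).elim
    · exact Or.inl (by simp [graphDom])
    · simp [graphDom]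
  · obtain ⟨f, h₁, h₂⟩ := DoubleLasso.exists_extension h hh
    exact ⟨f, h₁, fun a _ a' _ => h₂ a a'⟩

end Loops

/-! ### The two sentences and their syntax -/

namespace FPFormula

/-- `y` is reachable from `x` by a nonempty `R`-path, where all triples that are passed on the way
are guarded by `G`. -/
def guardedReach : FPFormula lassoLang :=
  lfp 0 ![0, 1] (and (rel (L := lassoLang) LassoRel.G ![0, 0, 1])
    (or (rel (L := lassoLang) LassoRel.R ![0, 1])
      (exs [2] (and (rel (L := lassoLang) LassoRel.G ![0, 1, 2])
        (and (so 0 ![0, 2]) (rel (L := lassoLang) LassoRel.R ![2, 1])))))) ![0, 0]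

/-- The element `0` reaches an element satisfying `P` by a nonempty `R`-path. -/
def reachP : FPFormula lassoLang :=
  lfp 0 ![0] (and (eq 0 0) (exs [1] (and (rel (L := lassoLang) LassoRel.R ![0, 1])
    (or (rel (L := lassoLang) LassoRel.P ![1]) (so 0 ![1]))))) ![0]

/-- The sentence `∀ x₀ . α ∧ χ₁ → χ₂`, for formulas in which only `x₀` is free, written with guarded
quantifiers and guarded negations. -/
def allImp (α χ₁ χ₂ : FPFormula lassoLang) : FPFormula lassoLang :=
  exs [0] (and (eq 0 0) (not (exs [0] (and α (and χ₁ (and (eq 0 0) (not χ₂)))))))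

/-- Every element satisfying `Q` lies on a cycle. -/
def allOnCycle : FPFormula lassoLang :=
  allImp (rel (L := lassoLang) LassoRel.Q ![0]) (eq 0 0) guardedReach

/-- Every element satisfying `Q` and `P` reaches an element satisfying `P`. -/
def allReturnToP : FPFormula lassoLang :=
  allImp (rel (L := lassoLang) LassoRel.Q ![0]) (rel (L := lassoLang) LassoRel.P ![0]) reachP

theorem freeVars_guardedReach : guardedReach.freeVars = {0} := by
  ext n
  simp [guardedReach, freeVars, exs, Matrix.range_cons]

theorem freeVars_reachP : reachP.freeVars = {0} := by
  ext n
  simp [reachP, freeVars, exs, Matrix.range_cons]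

/-- The intermediate point is quantified together with both endpoints, which no `R`-atom can guard;
this is the role of the ternary symbol. -/
theorem isGFP_guardedReach : guardedReach.IsGFP := by
  refine .lfp _ _ _ (by decide) (.rel _ _) ?_ (.or (.rel _ _)
    (.guardedEx _ (.rel _ _) (.and (.so _ _) (.rel _ _)) ?_ ?_)) ?_ ?_
  all_goals simp [freeVars, exs, Matrix.range_cons, HasPolarity, Set.subset_def]

theorem isGNFP_guardedReach : guardedReach.IsGNFP := by
  refine .lfp _ _ _ (by decide) (.rel _ _) ?_ (.or (.rel _ _)
    (.ex _ (.and (.rel _ _) (.and (.so _ _) (.rel _ _))))) ?_ ?_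
  all_goals simp [freeVars, exs, Matrix.range_cons, HasPolarity]

theorem isGFP_reachP : reachP.IsGFP := by
  refine .lfp _ _ _ (by decide) (.eq _ _) ?_
    (.guardedEx _ (.rel _ _) (.or (.rel _ _) (.so _ _)) ?_ ?_) ?_ ?_
  all_goals simp [freeVars, exs, Matrix.range_cons, HasPolarity]

theorem isGNFP_reachP : reachP.IsGNFP := by
  refine .lfp _ _ _ (by decide) (.eq _ _) ?_
    (.ex _ (.and (.rel _ _) (.or (.rel _ _) (.so _ _)))) ?_ ?_
  all_goals simp [freeVars, exs, Matrix.range_cons, HasPolarity]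

section AllImp

variable {α χ₁ χ₂ : FPFormula lassoLang}

theorem isGFP_allImp (hα : α.IsGuard) (h₁ : χ₁.IsGFP) (h₂ : χ₂.IsGFP) (hfα : α.freeVars = {0})
    (hf₁ : χ₁.freeVars = {0}) (hf₂ : χ₂.freeVars = {0}) : (allImp α χ₁ χ₂).IsGFP := by
  refine .guardedEx _ (.eq _ _) (.not (.guardedEx _ hα (.and h₁ (.and (.eq _ _) (.not h₂)))
    ?_ ?_)) ?_ ?_
  all_goals simp [freeVars, exs, hfα, hf₁, hf₂]

theorem isGNFP_allImp (hα : α.IsGNFP) (h₁ : χ₁.IsGNFP) (h₂ : χ₂.IsGNFP) (hfα : α.freeVars = {0})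
    (hf₁ : χ₁.freeVars = {0}) (hf₂ : χ₂.freeVars = {0}) : (allImp α χ₁ χ₂).IsGNFP := by
  refine .ex _ (.guardedNot (.eq _ _) (.ex _ (.and hα (.and h₁ (.guardedNot (.eq _ _) h₂ ?_)))) ?_)
  all_goals simp [freeVars, exs, hfα, hf₁, hf₂]

theorem isSentence_allImp (hfα : α.freeVars = {0}) (hf₁ : χ₁.freeVars = {0})
    (hf₂ : χ₂.freeVars = {0}) (hα : α.freeSOVars = ∅) (h₁ : χ₁.freeSOVars = ∅)
    (h₂ : χ₂.freeSOVars = ∅) : (allImp α χ₁ χ₂).IsSentence := by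
  constructor
  all_goals simp [allImp, freeVars, freeSOVars, exs, hfα, hf₁, hf₂, hα, h₁, h₂]

/-- The value `c` comes from the outer quantifier, whose only purpose is to supply a guard for the
outer negation; it is overwritten at once, and nonemptiness makes it harmless. -/
theorem realize_allImp {M : Type*} [lassoLang.Structure M] [Nonempty M] (v : ℕ → M)
    (V : (n : ℕ) → ℕ → Set (Fin n → M)) : (allImp α χ₁ χ₂).Realize v V ↔
      ∀ c a : M, α.Realize (Function.update (Function.update v 0 c) 0 a) V →
        χ₁.Realize (Function.update (Function.update v 0 c) 0 a) V →
        χ₂.Realize (Function.update (Function.update v 0 c) 0 a) V := by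
  simp [allImp, exs, Realize]

end AllImp

/-! ### Meaning of the two sentences -/

section Semantics

open FirstOrder.Language.Structure

variable {M : Type u} [lassoLang.Structure M]

variable (M) in
/-- The edge relation of a structure over `lassoLang`. -/
def edge (a b : M) : Prop := RelMap (L := lassoLang) LassoRel.R ![a, b]

theorem relMap_one (r : lassoLang.Relations 1) (a : Fin 1 → M) : RelMap r a ↔ RelMap r ![a 0] := by
  rw [show ![a 0] = a by ext i; fin_cases i; rfl]

theorem relMap_two (r : lassoLang.Relations 2) (a : Fin 2 → M) :
    RelMap r a ↔ RelMap r ![a 0, a 1] := by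
  rw [show ![a 0, a 1] = a by ext i; fin_cases i <;> rfl]

/-- The transitive closure is itself closed under the operator, whatever `G` is. The entailment
needs only this direction. -/
theorem transGen_of_realize_guardedReach {v : ℕ → M} {V : (n : ℕ) → ℕ → Set (Fin n → M)}
    (h : guardedReach.Realize v V) : Relation.TransGen (edge M) (v 0) (v 0) := by
  have hx : Function.Injective ![0, 1] := by decide
  refine h {a | Relation.TransGen (edge M) (a 0) (a 1)} ?_
  rintro a ⟨-, h | ⟨c, -, hU, hc⟩⟩
  · refine .single ?_
    have h := (relMap_two _ _).1 h
    have h0 := hx.extend_apply a v 0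
    have h1 := hx.extend_apply a v 1
    simp only [Matrix.cons_val_zero, Matrix.cons_val_one] at h h0 h1
    rwa [h0, h1] at h
  · have hc := (relMap_two _ _).1 hc
    have h0 := hx.extend_apply a v 0
    have h1 := hx.extend_apply a v 1
    simp only [Realize, Function.update_self] at hU
    simp at hU hc h0 h1
    rw [h0] at hU
    rw [h1] at hc
    exact hU.tail hc

theorem realize_guardedReach_of_transGen (hG : ∀ a : Fin 3 → M, RelMap (L := lassoLang) LassoRel.G a)
    {v : ℕ → M} {V : (n : ℕ) → ℕ → Set (Fin n → M)}
    (h : Relation.TransGen (edge M) (v 0) (v 0)) : guardedReach.Realize v V := by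
  have hx : Function.Injective ![0, 1] := by decide
  intro U hU
  -- The recursion appends edges at the end of the path, so the starting point stays fixed.
  have key : ∀ b, Relation.TransGen (edge M) (v 0) b → ![v 0, b] ∈ U := by
    intro b hb
    have h0 := fun b => hx.extend_apply ![v 0, b] v 0
    have h1 := fun b => hx.extend_apply ![v 0, b] v 1
    simp only [Matrix.cons_val_zero, Matrix.cons_val_one] at h0 h1
    induction hb with
    | @single b hb =>
      refine hU ⟨hG _, Or.inl ((relMap_two _ _).2 ?_)⟩
      simp only [Matrix.cons_val_zero, Matrix.cons_val_one]
      rw [h0, h1]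
      exact hb
    | @tail b c _ hc ih =>
      refine hU ⟨hG _, Or.inr ⟨b, hG _, ?_, (relMap_two _ _).2 ?_⟩⟩
      · simp only [Realize, Function.update_self]
        convert ih using 1
        ext i
        fin_cases i
        · simp [h0]
        · simp
      · simp [h1]
        exact hc
  have := key _ h
  convert this using 1
  ext i
  fin_cases i <;> rfl

theorem realize_reachP_iff {v : ℕ → M} {V : (n : ℕ) → ℕ → Set (Fin n → M)} :
    reachP.Realize v V ↔
      ∃ b, RelMap (L := lassoLang) LassoRel.P ![b] ∧ Relation.TransGen (edge M) (v 0) b := by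
  have hx : Function.Injective ![0] := by decide
  have h0 := fun a => hx.extend_apply (a : Fin 1 → M) v 0
  simp only [Matrix.cons_val_zero] at h0
  constructor
  · intro h
    refine h {a | ∃ b, RelMap (L := lassoLang) LassoRel.P ![b] ∧
      Relation.TransGen (edge M) (a 0) b} ?_
    rintro a ⟨-, c, hc, h⟩
    have hc := (relMap_two _ _).1 hc
    simp [h0] at hc
    rcases h with h | h
    · have h := (relMap_one _ _).1 h
      simp at h
      exact ⟨c, h, .single hc⟩
    · simp only [Realize, Function.update_self] at h
      obtain ⟨b, hb, hcb⟩ := h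
      simp at hcb
      exact ⟨b, hb, .head hc hcb⟩
  · rintro ⟨b, hb, hvb⟩ U hU
    -- Here the recursion prepends edges, so the target stays fixed.
    have key : ∀ a, Relation.TransGen (edge M) a b → ![a] ∈ U := by
      intro a ha
      induction ha using Relation.TransGen.head_induction_on with
      | @single a ha =>
        refine hU ⟨rfl, b, (relMap_two _ _).2 ?_, Or.inl ((relMap_one _ _).2 ?_)⟩
        · simp [h0]
          exact ha
        · simpa using hb
      | @head a c ha _ ih =>
        refine hU ⟨rfl, c, (relMap_two _ _).2 ?_, Or.inr ?_⟩
        · simp [h0]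
          exact ha
        · simp only [Realize, Function.update_self]
          convert ih using 1
          ext i
          fin_cases i
          simp
    have := key _ hvb
    convert this using 1
    ext i
    fin_cases i; rfl

theorem realize_allReturnToP_iff [Nonempty M] {v : ℕ → M} {V : (n : ℕ) → ℕ → Set (Fin n → M)} :
    allReturnToP.Realize v V ↔ ∀ a, RelMap (L := lassoLang) LassoRel.Q ![a] →
      RelMap (L := lassoLang) LassoRel.P ![a] →
      ∃ b, RelMap (L := lassoLang) LassoRel.P ![b] ∧ Relation.TransGen (edge M) a b := by
  simp only [allReturnToP, realize_allImp, realize_reachP_iff, Realize]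
  have e : ∀ a : M, (fun _ : Fin 1 => a) = ![a] := fun a => by
    ext i
    fin_cases i
    rfl
  simp [e]

/-- A cycle through `a` leads back to `a`, which is itself the required element of `P`. -/
theorem allOnCycle_entails_allReturnToP : Entails.{u} allOnCycle allReturnToP := by
  intro M _ _ v V h
  rw [realize_allReturnToP_iff]
  intro a hQ hP
  have := (realize_allImp v V).1 h a a ((relMap_one _ _).2 (by simpa using hQ)) rfl
  exact ⟨a, hP, by simpa using transGen_of_realize_guardedReach this⟩

theorem holds_allOnCycle [Nonempty M] (hG : ∀ a : Fin 3 → M, RelMap (L := lassoLang) LassoRel.G a)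
    (h : ∀ a, Relation.TransGen (edge M) a a) : allOnCycle.Holds M := fun v V =>
  (realize_allImp v V).2 fun _ _ _ _ => realize_guardedReach_of_transGen hG (h _)

end Semantics
end FPFormula

/-! ### Truth values in the two structures and refutation of interpolants -/

namespace FPFormula

open FirstOrder.Language.Structure

theorem singleLoop_transGen (k : ℕ) (a : SingleLoop k) :
    Relation.TransGen (edge (SingleLoop k)) a a := by
  -- Paths are nonempty, hence `n + 1` steps; `n = k` goes once around.
  have key : ∀ (n : ℕ) (a : Fin (k + 1)),
      Relation.TransGen (edge (SingleLoop k)) a (a + (n + 1) • (1 : Fin (k + 1)) : Fin (k + 1)) := by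
    intro n a
    induction n with
    | zero => exact .single (show a + _ = a + 1 by rw [zero_add, one_nsmul])
    | succ n ih => exact ih.tail (show a + _ = a + _ + 1 by rw [succ_nsmul, add_assoc])
  have e (b : Fin (k + 1)) : b + (k + 1) • (1 : Fin (k + 1)) = b := by
    simpa using card_nsmul_eq_zero (x := (1 : Fin (k + 1)))
  have main (b : Fin (k + 1)) : Relation.TransGen (edge (SingleLoop k)) b b := by
    have h := key k b
    rwa [e] at h
  exact main a

instance (k : ℕ) : Nonempty (SingleLoop k) := ⟨(0 : Fin (k + 1))⟩

instance (k : ℕ) : Nonempty (DoubleLasso k) := ⟨.mid⟩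

instance (k : ℕ) : Finite (SingleLoop k) := inferInstanceAs (Finite (Fin (k + 1)))

instance (k : ℕ) : Finite (DoubleLasso k) := by
  refine Finite.of_injective
    (β := Option (Fin (k + 1) ⊕ Fin (k + 1))) (fun a => match a with
      | .first i => some (.inl i)
      | .mid => none
      | .last i => some (.inr i)) ?_
  intro a b h
  cases a <;> cases b <;> simp_all

theorem singleLoop_holds_allOnCycle (k : ℕ) : allOnCycle.Holds (SingleLoop k) :=
  holds_allOnCycle (fun _ => trivial) (singleLoop_transGen k)

theorem doubleLasso_not_realize_allReturnToP (k : ℕ) (v : ℕ → DoubleLasso k)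
    (V : (n : ℕ) → ℕ → Set (Fin n → DoubleLasso k)) : ¬ allReturnToP.Realize v V := by
  rw [realize_allReturnToP_iff]
  intro h
  obtain ⟨b, hb, hmb⟩ := h .mid trivial rfl
  obtain rfl : b = .mid := hb
  -- The last loop is entered from `mid` and has no edge leaving it.
  have key : ∀ b, Relation.TransGen (edge (DoubleLasso k)) .mid b → ∃ i, b = .last i := by
    intro b hb
    induction hb with
    | single h =>
      have h : DoubleLasso.Edge _ _ := h
      cases h
      exact ⟨_, rfl⟩
    | tail _ h ih =>
      obtain ⟨i, rfl⟩ := ih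
      have h : DoubleLasso.Edge _ _ := h
      cases h
      exact ⟨_, rfl⟩
  obtain ⟨i, hi⟩ := key _ hmb
  cases hi

/-- No guarded negation fixpoint formula over `Q`, `R` separates the single loops from the double
lassos. -/
theorem not_exists_interpolant {φ ψ : FPFormula lassoLang}
    (hrels : φ.rels ∩ ψ.rels ⊆ {symbQ, symbR})
    (hφ : ∀ k, φ.Holds (SingleLoop k))
    (hψ : ∀ k (v : ℕ → DoubleLasso k) (V : (n : ℕ) → ℕ → Set (Fin n → DoubleLasso k)),
      ¬ ψ.Realize v V) :
    ¬ ∃ θ : FPFormula lassoLang, θ.IsGNFP ∧ IsInterpolant FinEntails.{u} φ ψ θ := by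
  rintro ⟨θ, hθ, hso, h₁, h₂, hr⟩
  -- The width depends on `θ`, which is why a whole family of structures is needed.
  obtain ⟨k, hk⟩ := hθ.exists_realize_of_bgnBisimilar (hr.trans hrels) hso
  -- Entailment quantifies over structures in universe `u`, so the two finite structures are lifted
  -- there, and truth is transported by `realize_equiv`.
  let e : SingleLoop k ≃ ULift.{u} (SingleLoop k) := Equiv.ulift.symm
  let f : DoubleLasso k ≃ ULift.{u} (DoubleLasso k) := Equiv.ulift.symm
  let _ : lassoLang.Structure (ULift.{u} (SingleLoop k)) := e.inducedStructure
  let _ : lassoLang.Structure (ULift.{u} (DoubleLasso k)) := f.inducedStructure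
  have he := fun (χ : FPFormula lassoLang) v V =>
    χ.realize_equiv e (fun n r a => Iff.rfl) v V
  have hf := fun (χ : FPFormula lassoLang) v V =>
    χ.realize_equiv f (fun n r a => Iff.rfl) v V
  have hA := (he θ (fun _ => Classical.arbitrary _) (fun _ _ => ∅)).1
    (h₁ _ _ _ ((he φ _ _).2 (hφ k _ _)))
  obtain ⟨w, hw⟩ := hk _ _ (bgnBisimilar_singleLoop_doubleLasso k) _ _
    (fun n X => {a | f ∘ a ∈ (∅ : Set (Fin n → ULift.{u} (DoubleLasso k)))}) hA
  exact hψ k _ _ ((hf ψ w _).1 (h₂ _ _ _ ((hf θ w _).2 hw)))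

theorem IsInterpolant.finEntails {L : FirstOrder.Language.{0, 0}} {φ ψ θ : FPFormula L}
    (h : IsInterpolant Entails.{u} φ ψ θ) : IsInterpolant FinEntails.{u} φ ψ θ :=
  ⟨h.1, fun M _ _ _ => h.2.1 M, fun M _ _ _ => h.2.2.1 M, h.2.2.2⟩

theorem rels_allOnCycle : allOnCycle.rels = {symbG, symbQ, symbR} := by
  simp only [allOnCycle, allImp, guardedReach, exs, rels, List.foldr, symbG, symbQ, symbR]
  ext r
  simp only [Set.mem_union, Set.mem_insert_iff, Set.mem_singleton_iff, Set.mem_empty_iff_false]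
  tauto

theorem rels_allReturnToP : allReturnToP.rels = {symbP, symbQ, symbR} := by
  simp only [allReturnToP, allImp, reachP, exs, rels, List.foldr, symbP, symbQ, symbR]
  ext r
  simp only [Set.mem_union, Set.mem_insert_iff, Set.mem_singleton_iff, Set.mem_empty_iff_false]
  tauto

theorem rels_inter_subset : allOnCycle.rels ∩ allReturnToP.rels ⊆ {symbQ, symbR} := by
  rw [rels_allOnCycle, rels_allReturnToP]
  rintro r ⟨rfl | h, h'⟩
  · rcases h' with h' | h' | h' <;> cases h'
  · exact h

theorem isSentence_allOnCycle : allOnCycle.IsSentence :=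
  isSentence_allImp (by simp [freeVars]) (by simp [freeVars]) freeVars_guardedReach rfl rfl
    (by simp [guardedReach, freeSOVars, exs])

theorem isSentence_allReturnToP : allReturnToP.IsSentence :=
  isSentence_allImp (by simp [freeVars]) (by simp [freeVars]) freeVars_reachP rfl rfl
    (by simp [reachP, freeSOVars, exs])

theorem isGNFP_allOnCycle : allOnCycle.IsGNFP :=
  isGNFP_allImp (.rel _ _) (.eq _ _) isGNFP_guardedReach (by simp [freeVars]) (by simp [freeVars])
    freeVars_guardedReach

theorem isGNFP_allReturnToP : allReturnToP.IsGNFP :=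
  isGNFP_allImp (.rel _ _) (.rel _ _) isGNFP_reachP (by simp [freeVars]) (by simp [freeVars])
    freeVars_reachP

theorem finite_relSymb_lassoLang : Finite (RelSymb lassoLang) := by
  refine Set.finite_univ_iff.1 ((Set.toFinite {symbG, symbP, symbQ, symbR}).subset ?_)
  rintro ⟨n, r⟩ -
  change LassoRel n at r
  cases r
  exacts [Or.inl rfl, Or.inr (Or.inl rfl), Or.inr (Or.inr (Or.inl rfl)),
    Or.inr (Or.inr (Or.inr rfl))]

end FPFormula

open FPFormula in
theorem proposition6p4 :
    ¬ FPFormula.HasCraigInterpolation (fun _ => FPFormula.IsGNFP)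
        (fun _ => FPFormula.Entails.{u}) ∧
    ¬ FPFormula.HasCraigInterpolation (fun _ => FPFormula.IsGNFP)
        (fun _ => FPFormula.FinEntails.{u}) ∧
    ∃ φ ψ : FPFormula lassoLang,
      φ.IsGFP ∧ φ.IsSentence ∧ φ.rels = {symbG, symbQ, symbR} ∧
      ψ.IsGFP ∧ ψ.IsSentence ∧ ψ.rels = {symbP, symbQ, symbR} ∧
      FPFormula.Entails.{u} φ ψ ∧
      (¬ ∃ θ : FPFormula lassoLang,
        θ.IsGNFP ∧ FPFormula.IsInterpolant FPFormula.Entails.{u} φ ψ θ) ∧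
      (¬ ∃ θ : FPFormula lassoLang,
        θ.IsGNFP ∧ FPFormula.IsInterpolant FPFormula.FinEntails.{u} φ ψ θ) ∧
      ∀ k : ℕ,
        φ.Holds (SingleLoop k) ∧ ¬ ψ.Holds (DoubleLasso k) ∧
        BGNBisimilar (SingleLoop k) (DoubleLasso k) k
          {symbQ, symbR} {symbQ, symbR} := by
  have hfin := not_exists_interpolant.{u} rels_inter_subset singleLoop_holds_allOnCycle
    doubleLasso_not_realize_allReturnToP
  have hall : ¬ ∃ θ : FPFormula lassoLang,
      θ.IsGNFP ∧ IsInterpolant Entails.{u} allOnCycle allReturnToP θ :=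
    fun ⟨θ, hθ, h⟩ => hfin ⟨θ, hθ, h.finEntails⟩
  have : lassoLang.IsRelational := fun _ => inferInstanceAs (IsEmpty Empty)
  have : Finite (RelSymb lassoLang) := finite_relSymb_lassoLang
  refine ⟨fun h => hall ?_, fun h => hfin ?_, allOnCycle, allReturnToP,
    isGFP_allImp (.rel _ _) (.eq _ _) isGFP_guardedReach (by simp [freeVars]) (by simp [freeVars])
      freeVars_guardedReach, isSentence_allOnCycle, rels_allOnCycle,
    isGFP_allImp (.rel _ _) (.rel _ _) isGFP_reachP (by simp [freeVars]) (by simp [freeVars])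
      freeVars_reachP, isSentence_allReturnToP, rels_allReturnToP,
    allOnCycle_entails_allReturnToP, hall, hfin, fun k => ⟨singleLoop_holds_allOnCycle k,
      fun h => doubleLasso_not_realize_allReturnToP k (fun _ => .mid) (fun _ _ => ∅) (h _ _),
      bgnBisimilar_singleLoop_doubleLasso k⟩⟩
  · exact h lassoLang _ _ isGNFP_allOnCycle isGNFP_allReturnToP isSentence_allOnCycle
      isSentence_allReturnToP allOnCycle_entails_allReturnToP
  · exact h lassoLang _ _ isGNFP_allOnCycle isGNFP_allReturnToP isSentence_allOnCycle
      isSentence_allReturnToP fun M _ _ _ => allOnCycle_entails_allReturnToP M
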